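/- **Setting.** Let $X$ be a random vector in $\mathbb{R}^{n_x}$ with law $\mathbb{P}_X$, $f\colon\mathbb{R}^{n_x}\to\mathbb{R}^{n_y}$ a (measurable) network, $a\in\mathbb{R}^{n_y}$, $b\in\mathbb{R}$. Let $\Theta\subseteq\mathbb{R}^p$, $h\colon\mathbb{R}^p\to\mathcal{P}(\mathbb{R}^{n_y})$ with $\{(\theta,y):\theta\in\Theta,\ y\in h(\theta)\}$ measurable, $\lambda\in\mathbb{R}$ and $v\colon\mathbb{R}^p\to\mathbb{R}$. Put, with values in $[-\infty,\infty]$, $$\hat r(\theta)=\inf\{a^\top y+b : y\in h(\theta)\},\qquad \bar r(\epsilon)=\sup\{r\in\mathbb{R} : \mathbb{P}_X(a^\top f(X)+b\ge r)\ge 1-\epsilon\}.$$ A set $S\subseteq\mathbb{R}^{n_y}$ is an *$\epsilon$-cover* if $\mathbb{P}_X(f(X)\in S)\ge 1-\epsilon$. For $y_1,\dots,y_N\in\mathbb{R}^{n_y}$, the *scenario program* is $$\text{maximize } \hat r(\theta)-\lambda v(\theta)\quad\text{subject to } y_j\in h(\theta)\ (j=1,\dots,N),\ \theta\in\Theta .$$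 A *solution* is a feasible point that attains the maximum, the maximum not being $-\infty$. The program is *convex* if $\Theta$ is convex, $\hat r-\lambda v$ is concave on $\Theta$ (that is, $\{(\theta,c)\in\Theta\times\mathbb{R}: c\le\hat r(\theta)-\lambda v(\theta)\}$ is convex), and $\{\theta\in\Theta : y\in h(\theta)\}$ is convex for almost every value $y$ of $f(X)$. **Theorem (High-probability guarantees).** Let $\epsilon,\delta\in(0,1]$, let $x_1,\dots,x_N$ be independent samples of $X$, and let $y_j=f(x_j)$. Assume that the scenario program is convex and is almost surely attained by a solution $\theta^*=\theta^*(y_1,\dots,y_N)$, depending measurably on the samples, which is the unique solution or, more generally, is singled out among the solutions by a convex tie-break rule: there are $k\ge 0$ fixed functions $t_1,\dots,t_k\colon\mathbb{R}^p\to\mathbb{R}$, convex on $\Theta$, such that every other solution $\theta'$ satisfies $(t_1(\theta^*),\dots,t_k(\theta^*))<(t_1(\theta'),\dots,t_k(\theta'))$ lexicographically ($k=0$ means that the solution is unique). If $$N\ \ge\ \frac{2}{\epsilon}\Big(\log\frac1\delta+p\Big),$$ then with probability at least $1-\delta$ over the samples the following both hold: 1. $h(\theta^*)$ is an $\epsilon$-cover,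 i.e. $\mathbb{P}_X(f(X)\in h(\theta^*))\ge 1-\epsilon$, where $X$ is independent of the samples; 2. $\hat r(\theta^*)\le\bar r(\epsilon)$. -/

import Mathlib

open MeasureTheory ProbabilityTheory

namespace ScenarioCert

/-- Approximate robustness level of a surrogate output set `S`: the infimum of the safety level
`aᵀy + b` over `y ∈ S`, as an extended real number. -/
noncomputable def approxRobustness {ny : ℕ} (a : EuclideanSpace ℝ (Fin ny)) (b : ℝ)
    (S : Set (EuclideanSpace ℝ (Fin ny))) : EReal :=
  ⨅ y ∈ S, ((inner ℝ a y + b : ℝ) : EReal)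

/-- Probabilistic robustness level of the network `f` under the input law `PX`: the supremum, as
an extended real number, of all real `r` with `PX (aᵀ f(X) + b ≥ r) ≥ 1 - ε`. -/
noncomputable def probRobustness {nx ny : ℕ}
    (PX : Measure (EuclideanSpace ℝ (Fin nx)))
    (f : EuclideanSpace ℝ (Fin nx) → EuclideanSpace ℝ (Fin ny))
    (a : EuclideanSpace ℝ (Fin ny)) (b ε : ℝ) : EReal :=
  sSup {c : EReal | ∃ r : ℝ, c = (r : EReal) ∧ 1 - ε ≤ PX.real {x | r ≤ inner ℝ a (f x) + b}}

/-- `S` is an `ε`-cover of the output of `f`: the output lies in `S` with probability at least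
`1 - ε`. -/
def IsEpsCover {nx ny : ℕ} (PX : Measure (EuclideanSpace ℝ (Fin nx)))
    (f : EuclideanSpace ℝ (Fin nx) → EuclideanSpace ℝ (Fin ny)) (ε : ℝ)
    (S : Set (EuclideanSpace ℝ (Fin ny))) : Prop :=
  1 - ε ≤ PX.real {x | f x ∈ S}

/-- Objective of the scenario program, `r̂(θ) - lam * v(θ)`, as an extended real number. -/
noncomputable def objective {p ny : ℕ} (a : EuclideanSpace ℝ (Fin ny)) (b : ℝ)
    (h : EuclideanSpace ℝ (Fin p) → Set (EuclideanSpace ℝ (Fin ny)))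
    (lam : ℝ) (v : EuclideanSpace ℝ (Fin p) → ℝ) (θ : EuclideanSpace ℝ (Fin p)) : EReal :=
  approxRobustness a b (h θ) - ((lam * v θ : ℝ) : EReal)

/-- Feasible set of the scenario program with output samples `y`. -/
def feasibleSet {p ny N : ℕ} (Θ : Set (EuclideanSpace ℝ (Fin p)))
    (h : EuclideanSpace ℝ (Fin p) → Set (EuclideanSpace ℝ (Fin ny)))
    (y : Fin N → EuclideanSpace ℝ (Fin ny)) : Set (EuclideanSpace ℝ (Fin p)) :=
  {θ | θ ∈ Θ ∧ ∀ j, y j ∈ h θ}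

/-- `F : ℝᵖ → [-∞, ∞]` is concave on `Θ`: its hypograph over `Θ` is convex. -/
def IsConcaveOn {p : ℕ} (Θ : Set (EuclideanSpace ℝ (Fin p)))
    (F : EuclideanSpace ℝ (Fin p) → EReal) : Prop :=
  Convex ℝ {q : EuclideanSpace ℝ (Fin p) × ℝ | q.1 ∈ Θ ∧ (q.2 : EReal) ≤ F q.1}

/-- The scenario program is convex: `Θ` is convex, the maximized objective is concave on `Θ`, and
for almost every output `y` of the law `PY` the constraint `y ∈ h(θ)` is convex in `θ ∈ Θ`. -/
structure IsConvexProgram {p ny : ℕ} (PY : Measure (EuclideanSpace ℝ (Fin ny)))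
    (Θ : Set (EuclideanSpace ℝ (Fin p)))
    (h : EuclideanSpace ℝ (Fin p) → Set (EuclideanSpace ℝ (Fin ny)))
    (F : EuclideanSpace ℝ (Fin p) → EReal) : Prop where
  convex_domain : Convex ℝ Θ
  concave_objective : IsConcaveOn Θ F
  convex_constraint : ∀ᵐ y ∂PY, Convex ℝ {θ | θ ∈ Θ ∧ y ∈ h θ}

/-- `θ` maximizes `F` over `K`, with a value other than `-∞`. -/
def IsSolution {p : ℕ} (F : EuclideanSpace ℝ (Fin p) → EReal)
    (K : Set (EuclideanSpace ℝ (Fin p))) (θ : EuclideanSpace ℝ (Fin p)) : Prop :=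
  θ ∈ K ∧ F θ ≠ ⊥ ∧ ∀ θ' ∈ K, F θ' ≤ F θ

/-- `θ` is the solution singled out by the tie-break rule `t`: every other solution has a strictly
larger tuple `(t₁, …, t_k)` in the lexicographic order. For `k = 0` this says that `θ` is the only
solution. -/
def IsSelectedSolution {p k : ℕ} (F : EuclideanSpace ℝ (Fin p) → EReal)
    (K : Set (EuclideanSpace ℝ (Fin p))) (t : Fin k → EuclideanSpace ℝ (Fin p) → ℝ)
    (θ : EuclideanSpace ℝ (Fin p)) : Prop :=
  IsSolution F K θ ∧ ∀ θ', IsSolution F K θ' → θ' ≠ θ →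
    ∃ i, (∀ i' < i, t i' θ = t i' θ') ∧ t i θ < t i θ'

end ScenarioCert

/-! The core is a tail bound: the selected point has violation probability above `ε` with
probability at most `2 ^ p * (1 - ε / 2) ^ N`, and the sample size makes this at most `δ`.

Convexity enters only through Helly's theorem. Order parameters lexicographically by `(-F, t,
coordinates)`. The coordinates make the order strict, so every subfamily of constraints has at most
one optimum, although uniqueness is assumed only for the full program. The strictly better points
form a convex set disjoint from the intersection of the constraint sets, so in dimension `p` some
`p` or fewer constraints already exclude all better points. Hence the solution is the optimum for
every family `J` of constraints containing a suitable `I` with `|I| ≤ p`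
(`IsSelectedSolution.exists_support`).

The probabilistic part (`violation_prob_le_aux`) adds `K` ghost points and views the sample as
selected by an injection `σ` into all `N + K` positions. By Chebyshev, a solution with large
violation probability almost always violates a comparable fraction of these points, so the values of
`σ` avoid that fraction. The number of such `σ` is bounded by double counting pairs `(σ, J)`: each
`σ` has at least `2 ^ (N - p)` admissible `J`, and summing over all `J` gives a binomial expansion
(`card_mul_two_pow_le`). Dividing by the number of injections and letting `K → ∞` gives the tail
bound.

Claim 2 follows from claim 1: on a cover, `r̂` is itself an admissible level in the supremum that
defines `r̄`. -/

namespace ScenarioCert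

/-! ### Counting index choices -/

/-- Completions of a partial choice of indices: if the determined point `g σ` depends only on the
restriction of `σ` to `J`, and `σ` takes values in a set of at most `c` elements attached to `g σ`,
then there are at most `|S| ^ |J| * c ^ (N - |J|)` such `σ`. -/
theorem card_le_of_determined {N c : ℕ} {S P : Type*} [Fintype S] [DecidableEq S]
    (B : Finset (Fin N → S)) (g : (Fin N → S) → P) (sat : P → Finset S)
    (J : Finset (Fin N)) (hdet : ∀ σ ∈ B, ∀ τ ∈ B, (∀ j ∈ J, σ j = τ j) → g σ = g τ)
    (hsat : ∀ σ ∈ B, ∀ j, σ j ∈ sat (g σ)) (hc : ∀ σ ∈ B, (sat (g σ)).card ≤ c) :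
    B.card ≤ Fintype.card S ^ J.card * c ^ (N - J.card) := by
  classical
  let r : (Fin N → S) → (J → S) := fun σ j => σ j
  have hfib : ∀ τ ∈ B.image r, (B.filter fun σ => r σ = τ).card ≤ c ^ (N - J.card) := by
    intro τ hτ
    obtain ⟨σ₀, hσ₀, rfl⟩ := Finset.mem_image.1 hτ
    have hsub : (B.filter fun σ => r σ = r σ₀) ⊆
        Fintype.piFinset fun j => if j ∈ J then {σ₀ j} else sat (g σ₀) := by
      intro σ hσ
      obtain ⟨hσB, hσr⟩ := Finset.mem_filter.1 hσ
      have hJ : ∀ j ∈ J, σ j = σ₀ j := fun j hj => congrFun hσr ⟨j, hj⟩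
      rw [Fintype.mem_piFinset]
      intro j
      split_ifs with hj
      · simpa using hJ j hj
      · rw [← hdet σ hσB σ₀ hσ₀ hJ]
        exact hsat σ hσB j
    refine (Finset.card_le_card hsub).trans ?_
    rw [Fintype.card_piFinset, ← Finset.prod_mul_prod_compl J,
      Finset.prod_eq_one (s := J) fun j hj => by simp [hj], one_mul]
    refine (Finset.prod_le_pow_card _ _ c fun j hj => ?_).trans ?_
    · rw [if_neg (Finset.mem_compl.1 hj)]
      exact hc σ₀ hσ₀
    · rw [Finset.card_compl, Fintype.card_fin]
  refine (Finset.card_le_mul_card_image (f := r) B _ hfib).trans ?_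
  rw [mul_comm]
  refine Nat.mul_le_mul_right _ ((Finset.card_le_univ _).trans ?_)
  simp

/-- If each `σ ∈ B` has a set of at most `p` positions such that `g σ` is determined by `σ` on
every superset `J` of it (in the sense of `R J`), then averaging over all `J` bounds `|B|`. -/
theorem card_mul_two_pow_le {N c p : ℕ} {S P : Type*} [Fintype S] [DecidableEq S]
    (B : Finset (Fin N → S)) (g : (Fin N → S) → P) (sat : P → Finset S)
    (R : Finset (Fin N) → (Fin N → S) → P → Prop)
    (huniq : ∀ J σ τ θ θ', (∀ j ∈ J, σ j = τ j) → R J σ θ → R J τ θ' → θ = θ')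
    (hR : ∀ σ ∈ B, ∃ I : Finset (Fin N), I.card ≤ p ∧ ∀ J, I ⊆ J → R J σ (g σ))
    (hsat : ∀ σ ∈ B, ∀ j, σ j ∈ sat (g σ)) (hc : ∀ σ ∈ B, (sat (g σ)).card ≤ c) :
    B.card * 2 ^ N ≤ 2 ^ p * (Fintype.card S + c) ^ N := by
  classical
  -- The supersets of `I` alone contribute `2 ^ (N - |I|) ≥ 2 ^ (N - p)` families.
  have hlow : ∀ σ ∈ B, 2 ^ N ≤
      2 ^ p * ((Finset.univ : Finset (Finset (Fin N))).filter fun J => R J σ (g σ)).card := by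
    intro σ hσ
    obtain ⟨I, hI, hIR⟩ := hR σ hσ
    have hsub : Finset.Icc I Finset.univ ⊆
        (Finset.univ : Finset (Finset (Fin N))).filter fun J => R J σ (g σ) := fun J hJ =>
      Finset.mem_filter.2 ⟨Finset.mem_univ _, hIR J (Finset.mem_Icc.1 hJ).1⟩
    have hcard := Finset.card_le_card hsub
    rw [Finset.card_Icc_finset (Finset.subset_univ I), Finset.card_univ, Fintype.card_fin] at hcard
    refine le_trans ?_ (Nat.mul_le_mul_left _ hcard)
    rw [← pow_add]
    exact Nat.pow_le_pow_right two_pos (by omega)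
  have hup : ∀ J : Finset (Fin N), (B.filter fun σ => R J σ (g σ)).card ≤
      Fintype.card S ^ J.card * c ^ (N - J.card) := by
    intro J
    refine card_le_of_determined _ g sat J ?_ ?_ ?_
    · intro σ hσ τ hτ h
      exact huniq J σ τ _ _ h (Finset.mem_filter.1 hσ).2 (Finset.mem_filter.1 hτ).2
    · exact fun σ hσ => hsat σ (Finset.mem_filter.1 hσ).1
    · exact fun σ hσ => hc σ (Finset.mem_filter.1 hσ).1
  calc B.card * 2 ^ N = ∑ σ ∈ B, 2 ^ N := by simp
    _ ≤ ∑ σ ∈ B, 2 ^ p *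
        ((Finset.univ : Finset (Finset (Fin N))).filter fun J => R J σ (g σ)).card :=
      Finset.sum_le_sum hlow
    _ = 2 ^ p * ∑ J : Finset (Fin N), (B.filter fun σ => R J σ (g σ)).card := by
      rw [← Finset.mul_sum]
      simp only [Finset.card_filter]
      rw [Finset.sum_comm]
    _ ≤ 2 ^ p * ∑ J : Finset (Fin N), Fintype.card S ^ J.card * c ^ (N - J.card) :=
      Nat.mul_le_mul_left _ (Finset.sum_le_sum fun J _ => hup J)
    _ = 2 ^ p * (Fintype.card S + c) ^ N := by
      have := Fintype.sum_pow_mul_eq_add_pow (Fin N) (Fintype.card S) c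
      rw [Fintype.card_fin] at this
      rw [this]

/-! ### Lexicographic order and convexity -/

theorem toLex_smul_lt {m : ℕ} {u w : Fin m → ℝ} {c : ℝ} (hc : 0 < c)
    (h : toLex u < toLex w) : toLex (c • u) < toLex (c • w) := by
  obtain ⟨i, hi, hlt⟩ := h
  refine ⟨i, fun j hj => ?_, ?_⟩
  · have := hi j hj
    simp only [Pi.toLex_apply, Pi.smul_apply, smul_eq_mul] at this ⊢
    rw [this]
  · simp only [Pi.toLex_apply, Pi.smul_apply, smul_eq_mul] at hlt ⊢
    exact mul_lt_mul_of_pos_left hlt hc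

/-- Strict lexicographic sublevel sets of a tuple of convex functions are closed under proper
convex combinations. -/
theorem toLex_combo_lt {m : ℕ} {E : Type*} [AddCommGroup E] [Module ℝ E] {s : Set E}
    {T : Fin m → E → ℝ} (hT : ∀ i, ConvexOn ℝ s (T i)) {x y : E} (hx : x ∈ s) (hy : y ∈ s)
    {w : Fin m → ℝ} (hxw : toLex (fun i => T i x) < toLex w)
    (hyw : toLex (fun i => T i y) < toLex w)
    {α β : ℝ} (hα : 0 < α) (hβ : 0 < β) (hαβ : α + β = 1) :
    toLex (fun i => T i (α • x + β • y)) < toLex w := by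
  have h1 : toLex (fun i => T i (α • x + β • y)) ≤
      toLex (α • (fun i => T i x) + β • (fun i => T i y)) :=
    Pi.toLex_monotone fun i => (hT i).2 hx hy hα.le hβ.le hαβ
  refine h1.trans_lt ?_
  have h2 := add_lt_add (toLex_smul_lt hα hxw) (toLex_smul_lt hβ hyw)
  rwa [← toLex_add, ← toLex_add, ← add_smul, hαβ, one_smul] at h2

/-- Lexicographic value `(-F, T)` of a point: smaller is better. -/
noncomputable def lexValue {m p : ℕ} (F : EuclideanSpace ℝ (Fin p) → EReal)
    (T : Fin m → EuclideanSpace ℝ (Fin p) → ℝ) (θ : EuclideanSpace ℝ (Fin p)) :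
    EReal ×ₗ Lex (Fin m → ℝ) :=
  toLex (-F θ, toLex fun i => T i θ)

theorem lexValue_lt {m p : ℕ} {F : EuclideanSpace ℝ (Fin p) → EReal}
    {T : Fin m → EuclideanSpace ℝ (Fin p) → ℝ} {θ θ' : EuclideanSpace ℝ (Fin p)} :
    lexValue F T θ < lexValue F T θ' ↔ F θ' < F θ ∨
      (F θ = F θ' ∧ toLex (fun i => T i θ) < toLex fun i => T i θ') := by
  rw [lexValue, lexValue, Prod.Lex.toLex_lt_toLex]
  simp [EReal.neg_lt_neg_iff]

theorem IsConcaveOn.le_combo {p : ℕ} {Θ : Set (EuclideanSpace ℝ (Fin p))}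
    {F : EuclideanSpace ℝ (Fin p) → EReal} (hF : IsConcaveOn Θ F)
    {x y : EuclideanSpace ℝ (Fin p)} (hx : x ∈ Θ) (hy : y ∈ Θ) {c d : ℝ}
    (hc : (c : EReal) ≤ F x) (hd : (d : EReal) ≤ F y)
    {α β : ℝ} (hα : 0 ≤ α) (hβ : 0 ≤ β) (hαβ : α + β = 1) :
    ((α * c + β * d : ℝ) : EReal) ≤ F (α • x + β • y) :=
  (hF (show (x, c) ∈ _ from ⟨hx, hc⟩) (show (y, d) ∈ _ from ⟨hy, hd⟩) hα hβ hαβ).2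

/-- The points strictly better than a point with finite objective form a convex set. -/
theorem convex_lexValue_lt {m p : ℕ} {Θ : Set (EuclideanSpace ℝ (Fin p))} (hΘ : Convex ℝ Θ)
    {F : EuclideanSpace ℝ (Fin p) → EReal} (hF : IsConcaveOn Θ F)
    {T : Fin m → EuclideanSpace ℝ (Fin p) → ℝ} (hT : ∀ i, ConvexOn ℝ Θ (T i))
    {θ₀ : EuclideanSpace ℝ (Fin p)} (hbot : F θ₀ ≠ ⊥) (htop : F θ₀ ≠ ⊤) :
    Convex ℝ {θ | θ ∈ Θ ∧ lexValue F T θ < lexValue F T θ₀} := by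
  rw [convex_iff_forall_pos]
  rintro x ⟨hx, hxl⟩ y ⟨hy, hyl⟩ α β hα hβ hαβ
  refine ⟨hΘ hx hy hα.le hβ.le hαβ, ?_⟩
  obtain ⟨c, hc⟩ : ∃ c : ℝ, (c : EReal) = F θ₀ := ⟨_, EReal.coe_toReal htop hbot⟩
  rw [lexValue_lt, ← hc] at hxl hyl ⊢
  -- Real minorants `d`, `e` replace `F x`, `F y`, which may be `⊤`. Both weights are positive, so
  -- one strict inequality suffices.
  have key : ∀ d e : ℝ, c ≤ d → c ≤ e → (c < d ∨ c < e) → (d : EReal) ≤ F x →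
      (e : EReal) ≤ F y → (c : EReal) < F (α • x + β • y) := by
    intro d e hcd hce h hd he
    refine lt_of_lt_of_le (EReal.coe_lt_coe_iff.2 ?_) (hF.le_combo hx hy hd he hα.le hβ.le hαβ)
    have : c = α * c + β * c := by rw [← add_mul, hαβ, one_mul]
    rcases h with h | h <;> nlinarith
  have hcx : (c : EReal) ≤ F x := hxl.elim le_of_lt fun h => h.1.ge
  have hcy : (c : EReal) ≤ F y := hyl.elim le_of_lt fun h => h.1.ge
  rcases hxl with h | ⟨hx1, hx2⟩
  · obtain ⟨d, hd, hd'⟩ := EReal.lt_iff_exists_real_btwn.1 h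
    exact Or.inl (key d c (EReal.coe_lt_coe_iff.1 hd).le le_rfl
      (Or.inl (EReal.coe_lt_coe_iff.1 hd)) hd'.le hcy)
  rcases hyl with h | ⟨hy1, hy2⟩
  · obtain ⟨d, hd, hd'⟩ := EReal.lt_iff_exists_real_btwn.1 h
    exact Or.inl (key c d le_rfl (EReal.coe_lt_coe_iff.1 hd).le
      (Or.inr (EReal.coe_lt_coe_iff.1 hd)) hcx hd'.le)
  have hle := hF.le_combo hx hy hcx hcy hα.le hβ.le hαβ
  rw [← add_mul, hαβ, one_mul] at hle
  rcases hle.lt_or_eq with h | h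
  · exact Or.inl h
  · exact Or.inr ⟨h.symm, toLex_combo_lt hT hx hy hx2 hy2 hα hβ hαβ⟩

/-- Tie-break functions `t` followed by the coordinates, which separate points. -/
noncomputable def withCoords {p k : ℕ} (t : Fin k → EuclideanSpace ℝ (Fin p) → ℝ) :
    Fin (k + p) → EuclideanSpace ℝ (Fin p) → ℝ :=
  Fin.append t fun i θ => θ i

theorem convexOn_withCoords {p k : ℕ} {Θ : Set (EuclideanSpace ℝ (Fin p))} (hΘ : Convex ℝ Θ)
    {t : Fin k → EuclideanSpace ℝ (Fin p) → ℝ} (ht : ∀ i, ConvexOn ℝ Θ (t i)) (i : Fin (k + p)) :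
    ConvexOn ℝ Θ (withCoords t i) := by
  refine Fin.addCases (fun j => ?_) (fun j => ?_) i
  · simpa [withCoords] using ht j
  · simp only [withCoords, Fin.append_right]
    exact ⟨hΘ, fun x _ y _ α β _ _ _ => by simp⟩

theorem lexValue_withCoords_injective {p k : ℕ} (F : EuclideanSpace ℝ (Fin p) → EReal)
    (t : Fin k → EuclideanSpace ℝ (Fin p) → ℝ) :
    Function.Injective (lexValue F (withCoords t)) := by
  intro θ θ' h
  have h2 : toLex (fun i => withCoords t i θ) = toLex fun i => withCoords t i θ' :=
    congrArg (fun q => (ofLex q).2) h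
  ext i
  simpa [withCoords] using congrFun (toLex.injective h2) (Fin.natAdd k i)

/-! ### Optimality and Helly's theorem -/

/-- `θ` is feasible for the constraints `y j`, `j ∈ J`, and no such point has a smaller value. -/
def IsLexOptimal {p ny N : ℕ} {V : Type*} [LT V] (Θ : Set (EuclideanSpace ℝ (Fin p)))
    (h : EuclideanSpace ℝ (Fin p) → Set (EuclideanSpace ℝ (Fin ny)))
    (Φ : EuclideanSpace ℝ (Fin p) → V) (J : Finset (Fin N))
    (y : Fin N → EuclideanSpace ℝ (Fin ny)) (θ : EuclideanSpace ℝ (Fin p)) : Prop :=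
  (θ ∈ Θ ∧ ∀ j ∈ J, y j ∈ h θ) ∧ ∀ θ', (θ' ∈ Θ ∧ ∀ j ∈ J, y j ∈ h θ') → ¬ Φ θ' < Φ θ

theorem IsLexOptimal.unique {p ny N : ℕ} {V : Type*} [LinearOrder V]
    {Θ : Set (EuclideanSpace ℝ (Fin p))}
    {h : EuclideanSpace ℝ (Fin p) → Set (EuclideanSpace ℝ (Fin ny))}
    {Φ : EuclideanSpace ℝ (Fin p) → V} (hΦ : Function.Injective Φ) {J : Finset (Fin N)}
    {y y' : Fin N → EuclideanSpace ℝ (Fin ny)} {θ θ' : EuclideanSpace ℝ (Fin p)}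
    (hy : ∀ j ∈ J, y j = y' j) (hθ : IsLexOptimal Θ h Φ J y θ)
    (hθ' : IsLexOptimal Θ h Φ J y' θ') : θ = θ' := by
  refine hΦ (le_antisymm (not_lt.1 (hθ.2 θ' ⟨hθ'.1.1, fun j hj => ?_⟩))
    (not_lt.1 (hθ'.2 θ ⟨hθ.1.1, fun j hj => ?_⟩)))
  · rw [hy j hj]; exact hθ'.1.2 j hj
  · rw [← hy j hj]; exact hθ.1.2 j hj

/-- The tie-break rule already decides between any two solutions within the first `k` entries, so
the appended coordinates never override it. -/
theorem IsSelectedSolution.isLexOptimal {p ny N k : ℕ} {Θ : Set (EuclideanSpace ℝ (Fin p))}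
    {h : EuclideanSpace ℝ (Fin p) → Set (EuclideanSpace ℝ (Fin ny))}
    {F : EuclideanSpace ℝ (Fin p) → EReal} {t : Fin k → EuclideanSpace ℝ (Fin p) → ℝ}
    {y : Fin N → EuclideanSpace ℝ (Fin ny)} {θ : EuclideanSpace ℝ (Fin p)}
    (hθ : IsSelectedSolution F (feasibleSet Θ h y) t θ) :
    IsLexOptimal Θ h (lexValue F (withCoords t)) Finset.univ y θ := by
  obtain ⟨⟨⟨hmem, hfeas⟩, hbot, hmax⟩, hsel⟩ := hθ
  refine ⟨⟨hmem, fun j _ => hfeas j⟩, fun θ' hθ' hlt => ?_⟩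
  have hK : θ' ∈ feasibleSet Θ h y := ⟨hθ'.1, fun j => hθ'.2 j (Finset.mem_univ j)⟩
  rcases lexValue_lt.1 hlt with h1 | ⟨h1, h2⟩
  · exact (hmax θ' hK).not_gt h1
  · have hne : θ' ≠ θ := by rintro rfl; exact lt_irrefl _ hlt
    obtain ⟨i, hi, hit⟩ := hsel θ' ⟨hK, h1 ▸ hbot, h1 ▸ hmax⟩ hne
    refine h2.not_gt ⟨Fin.castAdd p i, fun j hj => ?_, ?_⟩
    · obtain ⟨j, rfl⟩ : ∃ j' : Fin k, j = Fin.castAdd p j' := ⟨⟨j, lt_trans hj i.2⟩, rfl⟩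
      simpa [withCoords] using hi j hj
    · simpa [withCoords] using hit

/-- By Helly's theorem, an optimal point is already optimal for at most `p` of the constraints, and
for every larger family of them. -/
theorem IsLexOptimal.exists_support {p ny N : ℕ} {V : Type*} [LinearOrder V]
    {Θ : Set (EuclideanSpace ℝ (Fin p))}
    {h : EuclideanSpace ℝ (Fin p) → Set (EuclideanSpace ℝ (Fin ny))}
    {Φ : EuclideanSpace ℝ (Fin p) → V}
    {y : Fin N → EuclideanSpace ℝ (Fin ny)} {θ : EuclideanSpace ℝ (Fin p)}
    (hθ : IsLexOptimal Θ h Φ Finset.univ y θ)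
    (hbetter : Convex ℝ {θ' | θ' ∈ Θ ∧ Φ θ' < Φ θ})
    (hcon : ∀ j, Convex ℝ {θ' | θ' ∈ Θ ∧ y j ∈ h θ'}) :
    ∃ I : Finset (Fin N), I.card ≤ p ∧ ∀ J, I ⊆ J → IsLexOptimal Θ h Φ J y θ := by
  by_contra! hcontra
  have hex : ∀ I : Finset (Fin N), I.card ≤ p →
      ∃ θ', θ' ∈ Θ ∧ Φ θ' < Φ θ ∧ ∀ j ∈ I, y j ∈ h θ' := by
    intro I hI
    obtain ⟨J, hIJ, hJ⟩ := hcontra I hI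
    simp only [IsLexOptimal, not_and, not_forall, not_not] at hJ
    obtain ⟨θ', h1, h2⟩ := hJ ⟨hθ.1.1, fun j _ => hθ.1.2 j (Finset.mem_univ j)⟩
    exact ⟨θ', h1.1, h2, fun j hj => h1.2 j (hIJ hj)⟩
  let C : Option (Fin N) → Set (EuclideanSpace ℝ (Fin p)) := fun o =>
    o.elim {θ' | θ' ∈ Θ ∧ Φ θ' < Φ θ} fun j => {θ' | θ' ∈ Θ ∧ y j ∈ h θ'}
  -- Among `p + 1` sets, either the better set occurs with at most `p` constraints and `hex` gives a
  -- common point, or only constraints occur and `θ` lies in all of them.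
  have hne : (⋂ o ∈ (Finset.univ : Finset (Option (Fin N))), C o).Nonempty := by
    refine Convex.helly_theorem' (𝕜 := ℝ) ?_ ?_
    · rintro (_ | j) -
      · exact hbetter
      · exact hcon j
    · intro I _ hI
      rw [finrank_euclideanSpace_fin] at hI
      by_cases hnone : none ∈ I
      · have hcard : (Finset.eraseNone I).card ≤ p := by
          rw [Finset.card_eraseNone_of_mem hnone]; omega
        obtain ⟨θ', h1, h2, h3⟩ := hex _ hcard
        refine ⟨θ', Set.mem_iInter₂.2 ?_⟩
        rintro (_ | j) hj
        · exact ⟨h1, h2⟩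
        · exact ⟨h1, h3 j (Finset.mem_eraseNone.2 hj)⟩
      · refine ⟨θ, Set.mem_iInter₂.2 ?_⟩
        rintro (_ | j) hj
        · exact absurd hj hnone
        · exact ⟨hθ.1.1, hθ.1.2 j (Finset.mem_univ j)⟩
  obtain ⟨θ', hθ'⟩ := hne
  have hmem : ∀ o, θ' ∈ C o := fun o => Set.mem_iInter₂.1 hθ' o (Finset.mem_univ o)
  exact hθ.2 θ' ⟨(hmem none).1, fun j _ => (hmem (some j)).2⟩ (hmem none).2

/-! ### Ghost samples and the tail bound -/

/-- Distinct coordinates of an i.i.d. family are again i.i.d. This makes all injective subsamples,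
and all permutations, equivalent in law. -/
theorem pi_map_comp_of_injective {ι κ Y : Type*} [Fintype ι] [Fintype κ] [MeasurableSpace Y]
    (μ : Measure Y) [IsProbabilityMeasure μ] {σ : ι → κ} (hσ : Function.Injective σ) :
    MeasurePreserving (fun y : κ → Y => fun i => y (σ i))
      (Measure.pi fun _ : κ => μ) (Measure.pi fun _ : ι => μ) := by
  refine ⟨by fun_prop, ?_⟩
  have h := (iIndepFun_pi (μ := fun _ : κ => μ) (X := fun _ => id)
    fun _ => aemeasurable_id).precomp hσ
  have h2 := (iIndepFun_iff_map_fun_eq_pi_map fun i => (measurable_pi_apply (σ i)).aemeasurable).1 h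
  refine h2.trans ?_
  congr 1
  funext i
  exact (measurePreserving_eval (fun _ : κ => μ) (σ i)).map_eq

/-- Number of the points `z i` that violate `θ`, where `A` is the set of satisfied pairs. -/
noncomputable def violationCount {ι P Y : Type*} [Fintype ι] (A : Set (P × Y)) (θ : P)
    (z : ι → Y) : ℝ :=
  ∑ i, {y | (θ, y) ∉ A}.indicator 1 (z i)

theorem measurable_violationCount {ι P Y : Type*} [Fintype ι] [MeasurableSpace P]
    [MeasurableSpace Y] {A : Set (P × Y)} (hA : MeasurableSet A) :
    Measurable fun q : P × (ι → Y) => violationCount A q.1 q.2 := by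
  refine Finset.measurable_sum _ fun i _ => ?_
  have : Measurable fun q : P × (ι → Y) => (q.1, q.2 i) := by fun_prop
  exact (measurable_one.indicator hA.compl).comp this

/-- Chebyshev's inequality: the empirical violation frequency is rarely much smaller than the
violation probability. -/
theorem violationCount_le_prob {P Y : Type*} [MeasurableSpace Y]
    (μ : Measure Y) [IsProbabilityMeasure μ] (A : Set (P × Y)) (θ : P)
    (hA : MeasurableSet {y | (θ, y) ∉ A}) {ε η : ℝ} (hη : 0 < η)
    (hε : ε < μ.real {y | (θ, y) ∉ A}) {K : ℕ} (hK : 0 < K) :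
    (Measure.pi fun _ : Fin K => μ)
      {z | violationCount A θ z ≤ (ε - η) * K} ≤ ENNReal.ofReal (1 / (η ^ 2 * K)) := by
  set W : Set Y := {y | (θ, y) ∉ A} with hW
  set π := Measure.pi fun _ : Fin K => μ
  let X : Fin K → Y → ℝ := fun _ => W.indicator 1
  have hXm : Measurable (W.indicator (1 : Y → ℝ)) := measurable_one.indicator hA
  have hXb : ∀ y, W.indicator (1 : Y → ℝ) y ∈ Set.Icc (0 : ℝ) 1 := fun y => by
    by_cases hy : y ∈ W <;> simp [hy]
  have hL : ∀ i, MemLp (X i) 2 μ := fun i =>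
    MemLp.of_bound hXm.aestronglyMeasurable 1 (Filter.Eventually.of_forall fun y => by
      rw [Real.norm_eq_abs, abs_le]
      exact ⟨by linarith [(hXb y).1], (hXb y).2⟩)
  have hsum : (∑ i, fun z : Fin K → Y => X i (z i)) = fun z => violationCount A θ z := by
    funext z
    simp [violationCount, X, hW]
  have hXi : ∀ i : Fin K, MemLp (fun z : Fin K → Y => X i (z i)) 2 π := fun i =>
    (hL i).comp_measurePreserving (measurePreserving_eval (fun _ : Fin K => μ) i)
  have hSL : MemLp (fun z => violationCount A θ z) 2 π := by
    rw [← hsum]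
    exact memLp_finsetSum' _ fun i _ => hXi i
  have hvar : Var[fun z => violationCount A θ z; π] ≤ K := by
    rw [← hsum, variance_sum_pi hL]
    calc ∑ i, Var[X i; μ] ≤ ∑ i : Fin K, (1 : ℝ) := Finset.sum_le_sum fun i _ => by
          refine (variance_le_sq_of_bounded (a := 0) (b := 1)
            (Filter.Eventually.of_forall hXb) hXm.aemeasurable).trans ?_
          norm_num
      _ = K := by simp
  have hmean : ∫ z, violationCount A θ z ∂π = K * μ.real W := by
    change ∫ z : Fin K → Y, ∑ i, W.indicator (1 : Y → ℝ) (z i) ∂π = _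
    rw [integral_finsetSum _ fun i _ => (hXi i).integrable (by norm_num)]
    have : ∀ i : Fin K, ∫ z, W.indicator (1 : Y → ℝ) (z i) ∂π = μ.real W := fun i => by
      rw [integral_comp_eval (μ := fun _ : Fin K => μ) hXm.aestronglyMeasurable,
        integral_indicator_one hA]
    rw [Finset.sum_congr rfl fun i _ => this i]
    simp
  have hK' : (0 : ℝ) < K := by exact_mod_cast hK
  refine (measure_mono fun z hz => ?_).trans
    ((meas_ge_le_variance_div_sq hSL (mul_pos hη hK')).trans (ENNReal.ofReal_le_ofReal ?_))
  · rw [Set.mem_ofPred_eq] at hz ⊢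
    rw [hmean, abs_sub_comm]
    refine le_trans ?_ (le_abs_self _)
    nlinarith
  · rw [div_le_div_iff₀ (by positivity) (by positivity)]
    nlinarith [sq_nonneg (η : ℝ), mul_le_mul_of_nonneg_right hvar
      (by positivity : (0 : ℝ) ≤ η ^ 2 * K)]

/-- Augmenting the sample `y` by `K` further points, with overwhelming probability either the point
`g y` has violation at most `ε`, or it is violated by at least `(ε - η) * K` of all the points. -/
theorem violation_le_add_empirical {P Y : Type*} [MeasurableSpace P] [MeasurableSpace Y]
    (μ : Measure Y) [IsProbabilityMeasure μ] {A : Set (P × Y)} (hA : MeasurableSet A) {N : ℕ}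
    {g : (Fin N → Y) → P} (hg : Measurable g) {ε η : ℝ} (hη : 0 < η) {K : ℕ} (hK : 0 < K)
    {σ : Fin N → Fin N ⊕ Fin K} (hσ : Function.Injective σ) :
    (Measure.pi fun _ : Fin N => μ).real {y | ε < μ.real {z | (g y, z) ∉ A}} ≤
      1 / (η ^ 2 * K) + (Measure.pi fun _ : Fin N ⊕ Fin K => μ).real
        {Y' | ε < μ.real {z | (g fun i => Y' (σ i), z) ∉ A} ∧
          (ε - η) * K < violationCount A (g fun i => Y' (σ i)) Y'} := by
  set πN := Measure.pi fun _ : Fin N => μ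
  set πK := Measure.pi fun _ : Fin K => μ
  set πS := Measure.pi fun _ : Fin N ⊕ Fin K => μ
  have hV : Measurable fun θ => μ.real {z | (θ, z) ∉ A} :=
    (measurable_measure_prodMk_left (ν := μ) hA.compl).ennreal_toReal
  have hbad : MeasurableSet {y : Fin N → Y | ε < μ.real {z | (g y, z) ∉ A}} :=
    measurableSet_lt measurable_const (hV.comp hg)
  -- The permutation moves the subsample to the first block. The second block is then independent of
  -- it, so Chebyshev applies with `g y` fixed.
  obtain ⟨e, he⟩ := Equiv.Perm.exists_extending_pair (Sum.inl : Fin N → Fin N ⊕ Fin K) σ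
    Sum.inl_injective hσ
  have hsmall : πS.real {Y' | ε < μ.real {z | (g fun i => Y' (σ i), z) ∉ A} ∧
      violationCount A (g fun i => Y' (σ i)) Y' ≤ (ε - η) * K} ≤ 1 / (η ^ 2 * K) := by
    let D : Set ((Fin N → Y) × (Fin K → Y)) := {q | ε < μ.real {z | (g q.1, z) ∉ A} ∧
      violationCount A (g q.1) q.2 ≤ (ε - η) * K}
    have hD : MeasurableSet D := by
      have hcount : Measurable fun q : (Fin N → Y) × (Fin K → Y) =>
          violationCount A (g q.1) q.2 :=
        (measurable_violationCount hA).comp ((hg.comp measurable_fst).prodMk measurable_snd)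
      exact (measurableSet_lt measurable_const (hV.comp (hg.comp measurable_fst))).inter
        (measurableSet_le hcount measurable_const)
    have hDle : (πN.prod πK) D ≤ ENNReal.ofReal (1 / (η ^ 2 * K)) := by
      rw [Measure.prod_apply hD]
      refine (lintegral_mono (g := fun _ => ENNReal.ofReal (1 / (η ^ 2 * K)))
        fun y => ?_).trans (by simp)
      by_cases hy : ε < μ.real {z | (g y, z) ∉ A}
      · refine (measure_mono fun z hz => hz.2).trans
          (violationCount_le_prob μ A (g y) ?_ hη hy hK)
        exact measurable_prodMk_left hA.compl
      · have : Prod.mk y ⁻¹' D = ∅ := Set.eq_empty_of_forall_notMem fun z hz => hy hz.1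
        rw [this, measure_empty]
        exact zero_le
    have hmp := (measurePreserving_sumPiEquivProdPi
      (fun _ : Fin N ⊕ Fin K => μ)).comp (pi_map_comp_of_injective μ e.injective)
    refine ENNReal.toReal_le_of_le_ofReal (by positivity) ((measure_mono ?_).trans
      ((hmp.measure_preimage hD.nullMeasurableSet).trans_le hDle))
    rintro Y' ⟨h1, h2⟩
    have hinl : (fun i => Y' (e (Sum.inl i))) = fun i => Y' (σ i) := by
      funext i; rw [he]
    change ε < μ.real {z | (g fun i => Y' (e (Sum.inl i)), z) ∉ A} ∧
      violationCount A (g fun i => Y' (e (Sum.inl i))) (fun i => Y' (e (Sum.inr i))) ≤ (ε - η) * K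
    rw [hinl]
    -- Counting violations over all points instead of the fresh ones only increases the count.
    refine ⟨h1, le_trans ?_ h2⟩
    simp only [violationCount]
    rw [← Equiv.sum_comp e, Fintype.sum_sum_type]
    exact le_add_of_nonneg_left (Finset.sum_nonneg fun i _ =>
      Set.indicator_nonneg (fun _ _ => zero_le_one) _)
  have hproj := pi_map_comp_of_injective μ hσ
  rw [← hproj.measureReal_preimage hbad.nullMeasurableSet]
  refine (measureReal_mono (fun Y' hY' => ?_)).trans
    ((measureReal_union_le _ _).trans (add_le_add_left hsmall _))
  by_cases h : violationCount A (g fun i => Y' (σ i)) Y' ≤ (ε - η) * K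
  · exact Or.inl ⟨hY', h⟩
  · exact Or.inr ⟨hY', not_le.1 h⟩

theorem card_satisfied_eq {ι P Y : Type*} [Fintype ι] (A : Set (P × Y)) (θ : P) (z : ι → Y)
    [DecidablePred fun i => (θ, z i) ∈ A] :
    ((Finset.univ.filter fun i => (θ, z i) ∈ A).card : ℝ) =
      Fintype.card ι - violationCount A θ z := by
  rw [eq_sub_iff_add_eq, violationCount, Finset.card_filter, Nat.cast_sum,
    ← Finset.sum_add_distrib]
  rw [Finset.sum_congr rfl (g := fun _ => (1 : ℝ))]
  · simp
  · intro i _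
    by_cases h : (θ, z i) ∈ A <;> simp [h]

/-- A bound with `K` auxiliary points on the probability that a point determined by few of the
samples is violated with probability more than `ε`. -/
theorem violation_prob_le_aux {P Y : Type*} [MeasurableSpace P] [MeasurableSpace Y]
    (μ : Measure Y) [IsProbabilityMeasure μ] {A : Set (P × Y)} (hA : MeasurableSet A) {N p : ℕ}
    {g : (Fin N → Y) → P} (hg : Measurable g)
    (R : Finset (Fin N) → (Fin N → Y) → P → Prop)
    (huniq : ∀ J y y' θ θ', (∀ j ∈ J, y j = y' j) → R J y θ → R J y' θ' → θ = θ')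
    (hae : ∀ᵐ y ∂(Measure.pi fun _ : Fin N => μ), (∀ j, (g y, y j) ∈ A) ∧
      ∃ I : Finset (Fin N), I.card ≤ p ∧ ∀ J, I ⊆ J → R J y (g y))
    {ε η : ℝ} (hη : 0 < η) (hε : ε ≤ 1) {K : ℕ} (hK : 0 < K) :
    (Measure.pi fun _ : Fin N => μ).real {y | ε < μ.real {z | (g y, z) ∉ A}} - 1 / (η ^ 2 * K) ≤
      2 ^ p * ((2 * (N / K + 1) - (ε - η)) / 2) ^ N := by
  classical
  set πS := Measure.pi fun _ : Fin N ⊕ Fin K => μ with hπS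
  set Q := (Measure.pi fun _ : Fin N => μ).real {y | ε < μ.real {z | (g y, z) ∉ A}} with hQ
  let D : (Fin N → Fin N ⊕ Fin K) → Set (Fin N ⊕ Fin K → Y) := fun σ =>
    {Y' | ε < μ.real {z | (g fun i => Y' (σ i), z) ∉ A} ∧
      (ε - η) * K < violationCount A (g fun i => Y' (σ i)) Y'}
  have hDm : ∀ σ, MeasurableSet (D σ) := by
    intro σ
    have hgσ : Measurable fun Y' : Fin N ⊕ Fin K → Y => g fun i => Y' (σ i) :=
      hg.comp (by fun_prop)
    have hV : Measurable fun θ => μ.real {z | (θ, z) ∉ A} :=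
      (measurable_measure_prodMk_left (ν := μ) hA.compl).ennreal_toReal
    exact (measurableSet_lt measurable_const (hV.comp hgσ)).inter
      (measurableSet_lt measurable_const
        ((measurable_violationCount hA).comp (hgσ.prodMk measurable_id)))
  let Inj : Finset (Fin N → Fin N ⊕ Fin K) := Finset.univ.filter Function.Injective
  -- Of the `N + K` positions, more than `K` remain free at each of the `N` choices.
  have hcardInj : ((K : ℝ)) ^ N ≤ Inj.card := by
    have h1 : Inj.card = (N + K).descFactorial N := by
      have := Fintype.card_embedding_eq (α := Fin N) (β := Fin N ⊕ Fin K)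
      rw [Fintype.card_sum, Fintype.card_fin, Fintype.card_fin] at this
      rw [← this, ← Fintype.card_congr (Equiv.subtypeInjectiveEquivEmbedding _ _),
        Fintype.card_subtype]
    rw [h1]
    have h2 := Nat.pow_sub_le_descFactorial (N + K) N
    have h3 : K ^ N ≤ (N + K + 1 - N) ^ N := Nat.pow_le_pow_left (by omega) N
    exact_mod_cast h3.trans h2
  have hK' : (0 : ℝ) < K := by exact_mod_cast hK
  -- The largest possible number of satisfied points when more than `(ε - η) * K` of the `N + K` are
  -- violated.
  let c : ℕ := ⌊(N : ℝ) + K - (ε - η) * K⌋₊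
  have hc0 : 0 ≤ (N : ℝ) + K - (ε - η) * K := by nlinarith [(Nat.cast_nonneg N : (0 : ℝ) ≤ N)]
  have hpoint : ∀ᵐ Y' ∂πS, ∑ σ ∈ Inj, (D σ).indicator (1 : (Fin N ⊕ Fin K → Y) → ℝ) Y' ≤
      2 ^ p * (2 * (N + K) - (ε - η) * K) ^ N / 2 ^ N := by
    have hall : ∀ᵐ Y' ∂πS, ∀ σ : Fin N → Fin N ⊕ Fin K, Function.Injective σ →
        (∀ j, (g fun i => Y' (σ i), Y' (σ j)) ∈ A) ∧
        ∃ I : Finset (Fin N), I.card ≤ p ∧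
          ∀ J, I ⊆ J → R J (fun i => Y' (σ i)) (g fun i => Y' (σ i)) := by
      rw [ae_all_iff]
      intro σ
      by_cases hσ : Function.Injective σ
      · filter_upwards [(pi_map_comp_of_injective μ hσ).quasiMeasurePreserving.ae hae] with Y' h _
        exact h
      · exact Filter.Eventually.of_forall fun _ h => absurd h hσ
    filter_upwards [hall] with Y' hY'
    let B := Inj.filter fun σ => Y' ∈ D σ
    have hsum : ∑ σ ∈ Inj, (D σ).indicator (1 : (Fin N ⊕ Fin K → Y) → ℝ) Y' = B.card := by
      simp [B, Finset.card_filter, Set.indicator_apply]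
    have hB : ∀ σ ∈ B, Function.Injective σ ∧ Y' ∈ D σ := fun σ hσ =>
      ⟨(Finset.mem_filter.1 (Finset.mem_filter.1 hσ).1).2, (Finset.mem_filter.1 hσ).2⟩
    have hcount := card_mul_two_pow_le (c := c) (p := p) B (fun σ => g fun i => Y' (σ i))
      (fun θ => Finset.univ.filter fun s => (θ, Y' s) ∈ A)
      (fun J σ θ => R J (fun i => Y' (σ i)) θ)
      (fun J σ τ θ θ' h => huniq J _ _ θ θ' fun j hj => by rw [h j hj])
      (fun σ hσ => (hY' σ (hB σ hσ).1).2)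
      (fun σ hσ j => Finset.mem_filter.2 ⟨Finset.mem_univ _, (hY' σ (hB σ hσ).1).1 j⟩)
      (fun σ hσ => by
        rw [Nat.le_floor_iff hc0, card_satisfied_eq]
        have := (hB σ hσ).2.2
        simp only [Fintype.card_sum, Fintype.card_fin, Nat.cast_add]
        linarith)
    rw [hsum, le_div_iff₀ (by positivity)]
    have hcast : (B.card : ℝ) * 2 ^ N ≤ 2 ^ p * ((N + K : ℝ) + c) ^ N := by
      simp only [Fintype.card_sum, Fintype.card_fin] at hcount
      exact_mod_cast hcount
    refine hcast.trans ?_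
    have := Nat.floor_le hc0
    gcongr
    change (N : ℝ) + K + (⌊(N : ℝ) + K - (ε - η) * K⌋₊ : ℝ) ≤ _
    linarith
  have hint : ∀ σ, Integrable ((D σ).indicator (1 : (Fin N ⊕ Fin K → Y) → ℝ)) πS := fun σ =>
    (integrable_const (1 : ℝ)).indicator (hDm σ)
  have hle : ∑ σ ∈ Inj, πS.real (D σ) ≤
      2 ^ p * (2 * (N + K) - (ε - η) * K) ^ N / 2 ^ N := by
    have h1 : ∑ σ ∈ Inj, πS.real (D σ) =
        ∫ Y', ∑ σ ∈ Inj, (D σ).indicator (1 : (Fin N ⊕ Fin K → Y) → ℝ) Y' ∂πS := by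
      rw [integral_finsetSum _ fun σ _ => hint σ]
      exact Finset.sum_congr rfl fun σ _ => (integral_indicator_one (hDm σ)).symm
    rw [h1]
    refine (integral_mono_ae (integrable_finsetSum _ fun σ _ => hint σ)
      (integrable_const _) hpoint).trans ?_
    simp
  have hge : Inj.card * (Q - 1 / (η ^ 2 * K)) ≤ ∑ σ ∈ Inj, πS.real (D σ) := by
    rw [← nsmul_eq_mul]
    refine Finset.card_nsmul_le_sum _ _ _ fun σ hσ => ?_
    have := violation_le_add_empirical μ hA hg (ε := ε) hη hK (Finset.mem_filter.1 hσ).2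
    linarith
  have hrhs : (2 : ℝ) ^ p * ((2 * (N / K + 1) - (ε - η)) / 2) ^ N =
      2 ^ p * (2 * (N + K) - (ε - η) * K) ^ N / 2 ^ N / K ^ N := by
    rw [mul_div_assoc, mul_div_assoc, ← div_pow, ← div_pow]
    congr 2
    field_simp
  rw [hrhs, le_div_iff₀ (by positivity)]
  -- Replacing `Inj.card` by its lower bound `K ^ N` needs a nonnegative factor; otherwise the bound
  -- is trivial.
  rcases le_total 0 (Q - 1 / (η ^ 2 * K)) with h0 | h0
  · calc _ = (K : ℝ) ^ N * (Q - 1 / (η ^ 2 * K)) := mul_comm _ _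
      _ ≤ Inj.card * (Q - 1 / (η ^ 2 * K)) := by gcongr
      _ ≤ _ := hge.trans hle
  · refine (mul_nonpos_of_nonpos_of_nonneg h0 (by positivity)).trans ?_
    have : 0 ≤ 2 * ((N : ℝ) + K) - (ε - η) * K := by
      nlinarith [(Nat.cast_nonneg N : (0 : ℝ) ≤ N)]
    positivity

/-- If `g y` satisfies all the samples `y j` and is determined by any family of samples containing a
suitable family of at most `p` of them, then it rarely has violation probability above `ε`. -/
theorem violation_prob_le {P Y : Type*} [MeasurableSpace P] [MeasurableSpace Y]
    (μ : Measure Y) [IsProbabilityMeasure μ] {A : Set (P × Y)} (hA : MeasurableSet A) {N p : ℕ}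
    {g : (Fin N → Y) → P} (hg : Measurable g)
    (R : Finset (Fin N) → (Fin N → Y) → P → Prop)
    (huniq : ∀ J y y' θ θ', (∀ j ∈ J, y j = y' j) → R J y θ → R J y' θ' → θ = θ')
    (hae : ∀ᵐ y ∂(Measure.pi fun _ : Fin N => μ), (∀ j, (g y, y j) ∈ A) ∧
      ∃ I : Finset (Fin N), I.card ≤ p ∧ ∀ J, I ⊆ J → R J y (g y))
    {ε : ℝ} (hε : ε ≤ 1) :
    (Measure.pi fun _ : Fin N => μ).real {y | ε < μ.real {z | (g y, z) ∉ A}} ≤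
      2 ^ p * (1 - ε / 2) ^ N := by
  set Q := (Measure.pi fun _ : Fin N => μ).real {y | ε < μ.real {z | (g y, z) ∉ A}} with hQ
  have hstep : ∀ η : ℝ, 0 < η → Q ≤ 2 ^ p * ((2 * (0 + 1) - (ε - η)) / 2) ^ N := by
    intro η hη
    have hK : Filter.Tendsto (fun K : ℕ => (K : ℝ)) Filter.atTop Filter.atTop :=
      tendsto_natCast_atTop_atTop
    have h0 : Filter.Tendsto (fun K : ℕ => (N : ℝ) / K) Filter.atTop (nhds 0) :=
      hK.const_div_atTop _
    have h1 : Filter.Tendsto (fun K : ℕ => 1 / (η ^ 2 * (K : ℝ))) Filter.atTop (nhds 0) :=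
      (hK.const_mul_atTop (by positivity)).const_div_atTop _
    have h2 : Filter.Tendsto (fun K : ℕ => Q - 1 / (η ^ 2 * (K : ℝ))) Filter.atTop (nhds Q) := by
      simpa using h1.const_sub Q
    -- As `K → ∞` with `η` fixed, both the Chebyshev error and the `N / K` excess vanish.
    refine le_of_tendsto_of_tendsto h2
      (((((((h0.add_const 1).const_mul 2).sub_const (ε - η)).div_const 2).pow N).const_mul
        (2 ^ p))) ?_
    filter_upwards [Filter.eventually_gt_atTop 0] with K hKpos
    exact violation_prob_le_aux μ hA hg R huniq hae hη hε hKpos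
  have hcont : Filter.Tendsto (fun η : ℝ => 2 ^ p * ((2 * (0 + 1) - (ε - η)) / 2) ^ N)
      (nhdsWithin 0 (Set.Ioi 0)) (nhds (2 ^ p * ((2 * (0 + 1) - (ε - 0)) / 2) ^ N)) :=
    Filter.Tendsto.mono_left (Continuous.tendsto (by fun_prop) 0) nhdsWithin_le_nhds
  have := ge_of_tendsto hcont (Filter.eventually_of_mem self_mem_nhdsWithin hstep)
  rwa [show (2 * (0 + 1) - (ε - 0)) / 2 = 1 - ε / 2 by ring] at this

/-! ### Sample size and robustness levels -/

/-- Uses `2 ≤ e` and `1 - x ≤ exp (-x)` at `x = ε / 2`, which is the origin of the factor `2 / ε`.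
-/
theorem two_pow_mul_pow_le {p N : ℕ} {ε δ : ℝ} (hε₀ : 0 < ε) (hε₁ : ε ≤ 1) (hδ₀ : 0 < δ)
    (hN : 2 / ε * (Real.log (1 / δ) + p) ≤ N) : (2 : ℝ) ^ p * (1 - ε / 2) ^ N ≤ δ := by
  have h1 : Real.log (1 / δ) + p ≤ ε / 2 * N := by
    rw [div_mul_eq_mul_div, div_le_iff₀ hε₀] at hN
    linarith
  rw [one_div, Real.log_inv] at h1
  have h2 : (1 - ε / 2) ^ N ≤ Real.exp (Real.log δ - p) := by
    calc (1 - ε / 2) ^ N ≤ Real.exp (-(ε / 2)) ^ N :=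
          pow_le_pow_left₀ (by linarith) (Real.one_sub_le_exp_neg _) N
      _ = Real.exp (N * -(ε / 2)) := (Real.exp_nat_mul _ _).symm
      _ ≤ _ := Real.exp_le_exp.2 (by linarith)
  have h3 : (2 : ℝ) ^ p ≤ Real.exp p := by
    rw [← mul_one (p : ℝ), Real.exp_nat_mul]
    exact pow_le_pow_left₀ (by norm_num) (by linarith [Real.add_one_le_exp (1 : ℝ)]) p
  calc (2 : ℝ) ^ p * (1 - ε / 2) ^ N ≤ Real.exp p * Real.exp (Real.log δ - p) :=
        mul_le_mul h3 h2 (pow_nonneg (by linarith) N) (Real.exp_pos _).le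
    _ = δ := by rw [← Real.exp_add, add_sub_cancel, Real.exp_log hδ₀]

theorem approxRobustness_le {ny : ℕ} (a : EuclideanSpace ℝ (Fin ny)) (b : ℝ)
    {S : Set (EuclideanSpace ℝ (Fin ny))} {y : EuclideanSpace ℝ (Fin ny)} (hy : y ∈ S) :
    approxRobustness a b S ≤ ((inner ℝ a y + b : ℝ) : EReal) :=
  iInf₂_le y hy

theorem objective_ne_top {p ny : ℕ} (a : EuclideanSpace ℝ (Fin ny)) (b : ℝ)
    {h : EuclideanSpace ℝ (Fin p) → Set (EuclideanSpace ℝ (Fin ny))} (lam : ℝ)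
    (v : EuclideanSpace ℝ (Fin p) → ℝ) {θ : EuclideanSpace ℝ (Fin p)}
    {y : EuclideanSpace ℝ (Fin ny)} (hy : y ∈ h θ) : objective a b h lam v θ ≠ ⊤ := by
  refine ne_top_of_le_ne_top (EReal.coe_ne_top (inner ℝ a y + b - lam * v θ)) ?_
  rw [EReal.coe_sub]
  exact EReal.sub_le_sub (approxRobustness_le a b hy) le_rfl

/-- The approximate robustness of a nonempty cover is a lower bound for the probabilistic
robustness. -/
theorem IsEpsCover.approxRobustness_le_probRobustness {nx ny : ℕ}
    {PX : Measure (EuclideanSpace ℝ (Fin nx))} [IsFiniteMeasure PX]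
    {f : EuclideanSpace ℝ (Fin nx) → EuclideanSpace ℝ (Fin ny)} {ε : ℝ}
    {S : Set (EuclideanSpace ℝ (Fin ny))} (hS : IsEpsCover PX f ε S) (hne : S.Nonempty)
    (a : EuclideanSpace ℝ (Fin ny)) (b : ℝ) :
    approxRobustness a b S ≤ probRobustness PX f a b ε := by
  obtain ⟨y, hy⟩ := hne
  rcases eq_or_ne (approxRobustness a b S) ⊥ with hbot | hbot
  · rw [hbot]; exact bot_le
  have htop : approxRobustness a b S ≠ ⊤ :=
    ne_top_of_le_ne_top (EReal.coe_ne_top _) (approxRobustness_le a b hy)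
  refine le_sSup ⟨(approxRobustness a b S).toReal, (EReal.coe_toReal htop hbot).symm,
    hS.trans (measureReal_mono fun x hx => ?_)⟩
  have h := approxRobustness_le a b (show f x ∈ S from hx)
  rw [← EReal.coe_toReal htop hbot] at h
  exact EReal.coe_le_coe_iff.1 h

/-- The scenario solution is determined by at most `p` of the samples. -/
theorem IsSelectedSolution.exists_support {p ny N k : ℕ} [NeZero N]
    {a : EuclideanSpace ℝ (Fin ny)} {b : ℝ} {Θ : Set (EuclideanSpace ℝ (Fin p))}
    {h : EuclideanSpace ℝ (Fin p) → Set (EuclideanSpace ℝ (Fin ny))} {lam : ℝ}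
    {v : EuclideanSpace ℝ (Fin p) → ℝ} {t : Fin k → EuclideanSpace ℝ (Fin p) → ℝ}
    (ht : ∀ i, ConvexOn ℝ Θ (t i)) (hΘ : Convex ℝ Θ)
    (hF : IsConcaveOn Θ (objective a b h lam v)) {y : Fin N → EuclideanSpace ℝ (Fin ny)}
    (hcon : ∀ j, Convex ℝ {θ | θ ∈ Θ ∧ y j ∈ h θ}) {θ : EuclideanSpace ℝ (Fin p)}
    (hθ : IsSelectedSolution (objective a b h lam v) (feasibleSet Θ h y) t θ) :
    ∃ I : Finset (Fin N), I.card ≤ p ∧ ∀ J, I ⊆ J →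
      IsLexOptimal Θ h (lexValue (objective a b h lam v) (withCoords t)) J y θ :=
  hθ.isLexOptimal.exists_support
    (convex_lexValue_lt hΘ hF (convexOn_withCoords hΘ ht) hθ.1.2.1
      (objective_ne_top a b lam v (hθ.1.1.2 0))) hcon

end ScenarioCert

theorem mainTheorem1
    {nx ny p N k : ℕ}
    -- input law and network
    (PX : Measure (EuclideanSpace ℝ (Fin nx))) [IsProbabilityMeasure PX]
    (f : EuclideanSpace ℝ (Fin nx) → EuclideanSpace ℝ (Fin ny)) (hf : Measurable f)
    -- safety level `aᵀy + b`
    (a : EuclideanSpace ℝ (Fin ny)) (b : ℝ)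
    -- parameter set, set-valued function, regularization
    (Θ : Set (EuclideanSpace ℝ (Fin p)))
    (h : EuclideanSpace ℝ (Fin p) → Set (EuclideanSpace ℝ (Fin ny)))
    (hh : MeasurableSet {q : EuclideanSpace ℝ (Fin p) × EuclideanSpace ℝ (Fin ny) |
      q.1 ∈ Θ ∧ q.2 ∈ h q.1})
    (lam : ℝ) (v : EuclideanSpace ℝ (Fin p) → ℝ)
    -- convex functions breaking ties between solutions (none if `k = 0`)
    (t : Fin k → EuclideanSpace ℝ (Fin p) → ℝ) (ht : ∀ i, ConvexOn ℝ Θ (t i))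
    (ε δ : ℝ) (hε₀ : 0 < ε) (hε₁ : ε ≤ 1) (hδ₀ : 0 < δ) (hδ₁ : δ ≤ 1)
    -- the scenario program is convex and attained by the solution `θstar y`
    (hconv : ScenarioCert.IsConvexProgram (PX.map f) Θ h
      (ScenarioCert.objective a b h lam v))
    (θstar : (Fin N → EuclideanSpace ℝ (Fin ny)) → EuclideanSpace ℝ (Fin p))
    (hθm : AEMeasurable θstar (Measure.pi fun _ : Fin N => PX.map f))
    (hθ : ∀ᵐ y ∂(Measure.pi fun _ : Fin N => PX.map f),
      ScenarioCert.IsSelectedSolution (ScenarioCert.objective a b h lam v)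
        (ScenarioCert.feasibleSet Θ h y) t (θstar y))
    -- sample size
    (hN : 2 / ε * (Real.log (1 / δ) + p) ≤ N)
    -- `N` independent samples of the input
    {Ω : Type*} [MeasurableSpace Ω] (Pr : Measure Ω) [IsProbabilityMeasure Pr]
    (x : Fin N → Ω → EuclideanSpace ℝ (Fin nx)) (hx : ∀ j, Measurable (x j))
    (hlaw : ∀ j, Pr.map (x j) = PX) (hindep : iIndepFun x Pr) :
    1 - δ ≤ Pr.real {ω |
      ScenarioCert.IsEpsCover PX f ε (h (θstar fun j => f (x j ω))) ∧
      ScenarioCert.approxRobustness a b (h (θstar fun j => f (x j ω))) ≤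
        ScenarioCert.probRobustness PX f a b ε} := by

  -- Without samples `h θ` could be empty and `r̂ = ⊤`, but the sample size condition then forces `δ
  -- = 1`.
  rcases Nat.eq_zero_or_pos N with hN0 | hNpos
  · have hlog : 0 ≤ Real.log (1 / δ) := Real.log_nonneg (by rw [le_div_iff₀ hδ₀]; linarith)
    have hsum : Real.log (1 / δ) + p ≤ 0 := by
      rw [hN0, Nat.cast_zero] at hN
      exact nonpos_of_mul_nonpos_right hN (by positivity)
    have hp : (0 : ℝ) ≤ p := Nat.cast_nonneg p
    have hδ : 1 ≤ δ := by
      rw [one_div, Real.log_inv] at hlog hsum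
      by_contra! hlt
      linarith [Real.log_neg hδ₀ hlt]
    exact (sub_nonpos.2 hδ).trans measureReal_nonneg
  have : NeZero N := ⟨hNpos.ne'⟩
  set μ : Measure (EuclideanSpace ℝ (Fin ny)) := PX.map f with hμ
  have : IsProbabilityMeasure μ := Measure.isProbabilityMeasure_map hf.aemeasurable
  set π : Measure (Fin N → EuclideanSpace ℝ (Fin ny)) := Measure.pi fun _ => μ with hπ
  set A : Set (EuclideanSpace ℝ (Fin p) × EuclideanSpace ℝ (Fin ny)) :=
    {q | q.1 ∈ Θ ∧ q.2 ∈ h q.1} with hA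
  let g := hθm.mk θstar
  have hg : Measurable g := hθm.measurable_mk
  have hcon : ∀ᵐ y ∂π, ∀ j, Convex ℝ {θ | θ ∈ Θ ∧ y j ∈ h θ} := by
    rw [ae_all_iff]
    exact fun j => (Measure.quasiMeasurePreserving_eval (fun _ : Fin N => μ) j).ae
      hconv.convex_constraint
  have hbad : π.real {y | ε < μ.real {z | (g y, z) ∉ A}} ≤ δ := by
    refine (ScenarioCert.violation_prob_le (p := p) μ hh hg
      (ScenarioCert.IsLexOptimal Θ h
        (ScenarioCert.lexValue (ScenarioCert.objective a b h lam v) (ScenarioCert.withCoords t)))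
      (fun J y y' θ θ' hy => ScenarioCert.IsLexOptimal.unique
        (ScenarioCert.lexValue_withCoords_injective _ t) hy) ?_ hε₁).trans
      (ScenarioCert.two_pow_mul_pow_le hε₀ hε₁ hδ₀ hN)
    filter_upwards [hθ, hθm.ae_eq_mk, hcon] with y hy hgy hcony
    rw [show g y = θstar y from hgy.symm]
    exact ⟨fun j => ⟨hy.1.1.1, hy.1.1.2 j⟩,
      hy.exists_support ht hconv.convex_domain hconv.concave_objective hcony⟩
  have hmeas : MeasurableSet {y | ε < μ.real {z | (g y, z) ∉ A}} :=
    measurableSet_lt measurable_const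
      (((measurable_measure_prodMk_left (ν := μ) hh.compl).ennreal_toReal).comp hg)
  have hY : MeasurePreserving (fun ω j => f (x j ω)) Pr π := by
    refine ⟨measurable_pi_lambda _ fun j => hf.comp (hx j), ?_⟩
    have h1 := (iIndepFun_iff_map_fun_eq_pi_map fun j => (hf.comp (hx j)).aemeasurable).1
      (hindep.comp (fun _ => f) fun _ => hf)
    refine h1.trans ?_
    rw [hπ]
    congr 1
    funext j
    rw [hμ, ← hlaw j, Measure.map_map hf (hx j)]
  have hgood : 1 - δ ≤ Pr.real ((fun ω j => f (x j ω)) ⁻¹'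
      {y | ε < μ.real {z | (g y, z) ∉ A}}ᶜ) := by
    rw [hY.measureReal_preimage hmeas.compl.nullMeasurableSet, probReal_compl_eq_one_sub hmeas]
    linarith
  -- The target event need not be measurable; it contains, up to a null set, the measurable good
  -- event stated for `g`.
  refine hgood.trans (ENNReal.toReal_mono (measure_ne_top _ _) (measure_mono_ae ?_))
  filter_upwards [hY.quasiMeasurePreserving.ae hθ, hY.quasiMeasurePreserving.ae hθm.ae_eq_mk]
    with ω hω hgω hωG
  have hle : μ.real {z | (g fun j => f (x j ω), z) ∉ A} ≤ ε := not_lt.1 hωG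
  change μ.real {z | (hθm.mk θstar fun j => f (x j ω), z) ∉ A} ≤ ε at hle
  rw [← hgω] at hle
  set θ := θstar fun j => f (x j ω)
  have hsec : MeasurableSet {z | (θ, z) ∈ A} := measurable_prodMk_left hh
  have hcover : ScenarioCert.IsEpsCover PX f ε (h θ) := by
    have h1 : μ.real {z | (θ, z) ∈ A} = 1 - μ.real {z | (θ, z) ∉ A} := by
      have := probReal_compl_eq_one_sub (μ := μ) hsec
      change μ.real {z | (θ, z) ∉ A} = _ at this
      linarith
    have h2 : μ.real {z | (θ, z) ∈ A} = PX.real (f ⁻¹' {z | (θ, z) ∈ A}) :=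
      map_measureReal_apply hf hsec
    calc 1 - ε ≤ PX.real (f ⁻¹' {z | (θ, z) ∈ A}) := by linarith
      _ ≤ PX.real {x | f x ∈ h θ} := measureReal_mono fun x hx => hx.2
  exact ⟨hcover, hcover.approxRobustness_le_probRobustness ⟨_, hω.1.1.2 0⟩ a b⟩
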